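/- Let $n\ge 3$, read all colours $1,\dots,n$ modulo $n$, and work over $\mathbb{Q}$. Let $\hat{\mathcal S}(n,n)$ be the graded $\mathbb{Q}$-linear strict $2$-category obtained as follows. Start from the diagrammatic Khovanov--Lauda $2$-category $\mathcal U(\widehat{\mathfrak{gl}}_n)$: its objects are the weights $\lambda\in\mathbb{Z}^n$, its $1$-morphisms are generated by $\mathcal E_{\pm i}\mathbf 1_\lambda\colon\lambda\to\lambda\pm(\epsilon_i-\epsilon_{i+1})$, and its $2$-morphisms are $\mathbb{Q}$-linear combinations of string diagrams generated by dots, crossings, cups and caps; it is fully cyclic, its degree-zero clockwise and counter-clockwise $i$-bubbles in a region labelled $\lambda$ equal $(-1)^{\lambda_{i+1}}$ and $(-1)^{\lambda_{i+1}-1}$, and the double crossing of upward strands coloured $i$ and $i+1$ is the diagram with a dot on the $(i+1)$-strand minus the diagram with a dot on the $i$-strand. Set to zero every diagram that has a region whose label is not in $\Lambda(n,n)=\{\lambda\in\mathbb{Z}_{\ge 0}^n:\sum_i\lambda_i=n\}$. Write $\mathbf 1_n=\mathbf 1_{(1^n)}$ and adjoin $1$-morphisms $\mathcal E_{+\delta},\mathcal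 E_{-\delta}\colon(1^n)\to(1^n)$ (upward and downward $\delta$-strands), with degree-$0$ cups and caps making them biadjoint inverses of each other ($\delta$-bubbles of both orientations equal $1$, and a $\delta$-cap followed by the corresponding $\delta$-cup is the identity of two parallel oppositely oriented $\delta$-strands), and, for each $i$, degree-$1$ $2$-morphisms $D_i\colon\mathcal E_{+\delta}\mathbf 1_n\to W_i$ and $M_i\colon W_i\to\mathcal E_{+\delta}\mathbf 1_n$, where $W_i=\mathcal E_i\mathcal E_{i-1}\cdots\mathcal E_1\mathcal E_n\cdots\mathcal E_{i+1}\mathbf 1_n$, together with their $180^\circ$ rotations, which do not depend on the sense of rotation. Writing $x_j$ for a dot on the strand coloured $j$ in a word $W_k$, these are subject to: * $D_iM_i=x_{i+1}-x_i$, and for $i\neq j$ the composite $D_jM_i\colon W_i\to W_j$ is the diagram in which the block of strands $i,\dots,j+1$ crosses the block $j,\dots,i+1$; * moving the last strand $i+1$ of $D_i$ to the far left gives $(x_{i+1}-x_i)D_{i+1}$, moving the first strand $i$ of $D_i$ to the far right gives $(x_{i+1}-x_i)D_{i-1}$, and the vertical reflections of these two relations hold for the $M_i$; * the composites $\mathcal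 E_{+\delta}\mathcal E_{-i}\to\mathcal E_{i-1}\cdots\mathcal E_{i+1}\to\mathcal E_{+\delta}\mathcal E_{-i}$ and $\mathcal E_{-i}\mathcal E_{+\delta}\to\mathcal E_{i-1}\cdots\mathcal E_{i+1}\to\mathcal E_{-i}\mathcal E_{+\delta}$, obtained from $D_{i-1},M_{i-1}$, respectively $D_i,M_i$, by closing the $i$-strand with a cap and a cup, are identities. For a $1$-morphism $X$ let $\mathrm{END}(X)$ be the graded $\mathbb{Q}$-algebra of all $2$-endomorphisms of $X$, of all degrees, under vertical composition. For $t\in\mathbb{Z}$ let $\mathcal E_{+\delta}^t$ be the $t$-th power of $\mathcal E_{+\delta}$ if $t\ge 0$, and the $|t|$-th power of $\mathcal E_{-\delta}$ if $t<0$. Then for every $t\in\mathbb{Z}$ both maps $$\mathrm{END}(\mathbf 1_n)\to\mathrm{END}(\mathcal E_{+\delta}^t\mathbf 1_n),\qquad f\mapsto 1_{\mathcal E_{+\delta}^t}f,\qquad f\mapsto f\,1_{\mathcal E_{+\delta}^t},$$ which place a closed diagram $f$ to the right, respectively to the left, of the $|t|$ identity $\delta$-strands, are isomorphisms of graded $\mathbb{Q}$-algebras.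 -/

import Mathlib

/-!  The graded `ℚ`-linear strict 2-category `Ŝ(n,n)`: the Schur quotient of the diagrammatic
2-category `U(ĝl_n)`, extended by the 1-morphisms `E_{+δ}`, `E_{-δ}` of the region `(1^n)`.

Colours `1, …, n` are the elements of `ZMod n` (so `n = 0` there), which makes all indices cyclic.
Diagrams are read from bottom (source) to top (target), and the word `a₁ a₂ … a_m` together with
the weight `l` of the rightmost region is the 1-morphism `a₁ a₂ ⋯ a_m 1_l`. -/

namespace AffineSchur

/-! ## Weights and 1-morphisms -/

/-- `gl_n`-weights: elements of `ℤ^n`, indexed cyclically. -/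
abbrev Wt (n : ℕ) : Type := ZMod n → ℤ

/-- The simple root `α_i = ε_i - ε_{i+1}`. -/
def root {n : ℕ} (i : ZMod n) : Wt n := Pi.single i 1 - Pi.single (i + 1) 1

/-- `l_i - l_{i+1}`. -/
def bar {n : ℕ} (l : Wt n) (i : ZMod n) : ℤ := l i - l (i + 1)

/-- The pairing `⟨α_i, α_j⟩` (for `n ≥ 3`). -/
def cartan {n : ℕ} (i j : ZMod n) : ℤ :=
  if i = j then 2 else if j = i + 1 ∨ i = j + 1 then -1 else 0

/-- `Λ(n,n)`: the compositions of `n` in `n` non-negative parts. -/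
def IsSchurWt {n : ℕ} [NeZero n] (l : Wt n) : Prop := (∀ i, 0 ≤ l i) ∧ ∑ i, l i = (n : ℤ)

/-- Orientations: upward strands and downward strands. -/
inductive Dir : Type
  | up
  | dn

def Dir.flip : Dir → Dir
  | up => dn
  | dn => up

def Dir.sgn : Dir → ℤ
  | up => 1
  | dn => -1

/-- The generating 1-morphisms: `root up i` is `E_{+i}`, `root dn i` is `E_{-i}`,
`delta up` is `E_{+δ}` and `delta dn` is `E_{-δ}`. -/
inductive Letter (n : ℕ) : Type
  | root (s : Dir) (i : ZMod n)
  | delta (s : Dir)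

abbrev Letter.E {n : ℕ} (i : ZMod n) : Letter n := .root .up i
abbrev Letter.F {n : ℕ} (i : ZMod n) : Letter n := .root .dn i

open Letter

/-- The letter with the opposite orientation (the biadjoint). -/
def Letter.dual {n : ℕ} : Letter n → Letter n
  | .root s i => .root s.flip i
  | .delta s => .delta s.flip

theorem Letter.dual_dual {n : ℕ} (a : Letter n) : a.dual.dual = a := by
  rcases a with ⟨_ | _, _⟩ | ⟨_ | _⟩ <;> rfl

def Letter.wt {n : ℕ} : Letter n → Wt n
  | .root s i => s.sgn • AffineSchur.root i
  | .delta _ => 0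

abbrev Word (n : ℕ) : Type := List (Letter n)

/-- The weight of the region to the left of a word, if `l` is the weight to its right. -/
def wt {n : ℕ} : Word n → Wt n → Wt n
  | [], l => l
  | a :: w, l => wt w l + a.wt

/-- The biadjoint word: reversed, with all orientations reversed. -/
def dual {n : ℕ} : Word n → Word n
  | [] => []
  | a :: w => dual w ++ [a.dual]

/-- All regions of the identity diagram of the word are labelled by elements of `Λ(n,n)`, and
the `δ`-strands lie in regions labelled `(1^n)`. -/
def Admissible {n : ℕ} [NeZero n] : Word n → Wt n → Prop
  | [], l => IsSchurWt l
  | .root s i :: w, l => Admissible w l ∧ IsSchurWt (wt (.root s i :: w) l)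
  | .delta _ :: w, l => Admissible w l ∧ wt w l = 1

/-- The word `E_{c₁} ⋯ E_{c_m}` of a list of colours. -/
def ups {n : ℕ} : List (ZMod n) → Word n
  | [] => []
  | c :: cs => E c :: ups cs

/-- The list of colours `i, i-1, …, 1, n, …, i+2, i+1`. -/
def cyc {n : ℕ} (i : ZMod n) : List (ZMod n) := (List.range n).map fun k => i - (k : ZMod n)

/-- `E_{+δ}^t`, which is `E_{-δ}^{-t}` for `t < 0`. -/
def deltaPow (n : ℕ) (t : ℤ) : Word n :=
  List.replicate t.natAbs (.delta (if 0 ≤ t then .up else .dn))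

theorem wt_deltaPow {n : ℕ} (t : ℤ) (l : Wt n) : wt (deltaPow n t) l = l := by
  unfold deltaPow
  induction t.natAbs with
  | zero => rfl
  | succ k ih => simp [List.replicate_succ, wt, ih, Letter.wt]

/-! ## Diagrams -/

/-- Formal `ℚ`-linear expressions in diagrams. `Tm l X Y` are those from `X 1_l` to `Y 1_l`.
`comp g f` is `g` on top of `f`, and `hcomp f g` is `f` to the left of `g`.

The trivalent-type generators are, for each `i`: `split` (`δ` at the bottom, the strands
`i, i-1, …, i+1` at the top), `merge` (the reverse), and `splitDn`, `mergeDn`, in which all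
strands point down: these have the downward strands `i+1, i+2, …, i` (the word dual to
`i, i-1, …, i+1`) at the top, respectively at the bottom. -/
inductive Tm {n : ℕ} : Wt n → Word n → Word n → Type
  | id (l : Wt n) (X : Word n) : Tm l X X
  | dot (s : Dir) (i : ZMod n) (l : Wt n) : Tm l [.root s i] [.root s i]
  | cross (s : Dir) (i j : ZMod n) (l : Wt n) :
      Tm l [.root s i, .root s j] [.root s j, .root s i]
  | cup (a : Letter n) (l : Wt n) : Tm l [] [a.dual, a]
  | cap (a : Letter n) (l : Wt n) : Tm l [a.dual, a] []
  | split (i : ZMod n) (cs : List (ZMod n)) (h : cs = cyc i) (l : Wt n) :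
      Tm l [.delta .up] (ups cs)
  | merge (i : ZMod n) (cs : List (ZMod n)) (h : cs = cyc i) (l : Wt n) :
      Tm l (ups cs) [.delta .up]
  | splitDn (i : ZMod n) (l : Wt n) : Tm l [.delta .dn] (dual (ups (cyc i)))
  | mergeDn (i : ZMod n) (l : Wt n) : Tm l (dual (ups (cyc i))) [.delta .dn]
  | comp {l : Wt n} {X Y Z : Word n} (g : Tm l Y Z) (f : Tm l X Y) : Tm l X Z
  | hcomp {l m : Wt n} {X' Y' X Y P Q : Word n} (f : Tm m X' Y') (g : Tm l X Y)
      (hm : wt X l = m) (hP : X' ++ X = P) (hQ : Y' ++ Y = Q) : Tm l P Q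
  | zero (l : Wt n) (X Y : Word n) : Tm l X Y
  | add {l : Wt n} {X Y : Word n} (f g : Tm l X Y) : Tm l X Y
  | smul {l : Wt n} {X Y : Word n} (c : ℚ) (f : Tm l X Y) : Tm l X Y

namespace Tm

variable {n : ℕ}

def sub {l : Wt n} {X Y : Word n} (f g : Tm l X Y) : Tm l X Y := add f (smul (-1) g)

/-- `f 0 + f 1 + ⋯ + f (k-1)`. -/
def sum {l : Wt n} {X Y : Word n} : (k : ℕ) → (Fin k → Tm l X Y) → Tm l X Y
  | 0, _ => zero l X Y
  | k + 1, f => add (sum k fun j => f j.castSucc) (f (Fin.last k))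

/-- The diagram `f` with the identity strands `L` to its left and `R` to its right. -/
def wh {l : Wt n} {X Y : Word n} (L R : Word n) (f : Tm (wt R l) X Y) :
    Tm l (L ++ (X ++ R)) (L ++ (Y ++ R)) :=
  hcomp (id (wt (X ++ R) l) L) (hcomp f (id l R) rfl rfl rfl) rfl rfl rfl

/-- Nested cups `1 → X* X`. -/
def cups (l : Wt n) : (X : Word n) → Tm l [] (dual X ++ X)
  | [] => id l []
  | a :: w => comp
      (hcomp (id (wt w l) (dual w)) (hcomp (cup a (wt w l)) (id l w) rfl rfl rfl)
        rfl rfl (by simp [dual]))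
      (cups l w)

/-- Nested caps `X* X → 1`. -/
def caps (l : Wt n) : (X : Word n) → Tm l (dual X ++ X) []
  | [] => id l []
  | a :: w => comp (caps l w)
      (hcomp (id (wt (a.dual :: a :: w) l) (dual w))
        (hcomp (cap a (wt w l)) (id l w) rfl rfl rfl) rfl (by simp [dual]) rfl)

theorem dual_append (X Y : Word n) : dual (X ++ Y) = dual Y ++ dual X := by
  induction X with
  | nil => simp [dual]
  | cons a w ih => simp [dual, ih]

theorem dual_dual (X : Word n) : dual (dual X) = X := by
  induction X with
  | nil => rfl
  | cons a w ih =>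
    simp [dual, dual_append, ih, a.dual_dual]

/-- Rotation by 180 degrees of a diagram `f : X → Y` (given for every region label):
`Y* → Y* X X* → Y* Y X* → X*`. -/
def rotR {X Y : Word n} (f : ∀ l : Wt n, Tm l X Y) (l : Wt n) : Tm l (dual Y) (dual X) :=
  comp (hcomp (caps (wt (dual X) l) Y) (id l (dual X)) rfl (List.append_assoc _ _ _) rfl)
    (comp (wh (dual Y) (dual X) (f (wt (dual X) l)))
      (hcomp (id l (dual Y)) (cups l (dual X)) rfl (List.append_nil _)
        (by rw [dual_dual])))

/-- Rotation by 180 degrees in the other sense: `Y* → X* X Y* → X* Y Y* → X*`. -/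
def rotL {X Y : Word n} (f : ∀ l : Wt n, Tm l X Y) (l : Wt n) : Tm l (dual Y) (dual X) :=
  comp (hcomp (id (wt (Y ++ dual Y) l) (dual X)) (caps l (dual Y)) (by rw [dual_dual])
      (by rw [dual_dual]) (List.append_nil _))
    (comp (wh (dual X) (dual Y) (f (wt (dual Y) l)))
      (hcomp (cups (wt (dual Y) l) X) (id l (dual Y)) rfl rfl (by simp)))

/-- An upward `i`-strand with `m` dots. -/
def dots (i : ZMod n) (l : Wt n) : ℕ → Tm l [E i] [E i]
  | 0 => id l [E i]
  | m + 1 => comp (dot .up i l) (dots i l m)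

/-- The upward strands `cs`, with a dot on the `k`-th one, counted from `0`
(`k` is less than the length of `cs` in all uses). -/
def dotAt (l : Wt n) : (cs : List (ZMod n)) → ℕ → Tm l (ups cs) (ups cs)
  | [], _ => zero l [] []
  | c :: cs, 0 => hcomp (dot .up c (wt (ups cs) l)) (id l (ups cs)) rfl rfl rfl
  | c :: cs, k + 1 => hcomp (id (wt (ups cs) l) [E c]) (dotAt l cs k) rfl rfl rfl

/-- The clockwise `i`-bubble with `m` dots, in a region labelled `l`. -/
def cw (i : ZMod n) (l : Wt n) (m : ℕ) : Tm l [] [] :=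
  comp (cap (F i) l) (comp (wh [] [F i] (dots i (wt [F i] l) m)) (cup (F i) l))

/-- The counter-clockwise `i`-bubble with `m` dots, in a region labelled `l`. -/
def ccw (i : ZMod n) (l : Wt n) (m : ℕ) : Tm l [] [] :=
  comp (cap (E i) l) (comp (wh [F i] [] (dots i l m)) (cup (E i) l))

/-- The clockwise `i`-bubble of degree `2 j`, i.e. with `l_i - l_{i+1} - 1 + j` dots. If that
number is negative, it is the fake bubble determined by the degree-zero normalization and the
homogeneous components of the infinite Grassmannian relation
`(∑ ccw_j t^j) (∑ cw_j t^j) = -1`. -/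
def cwB (i : ZMod n) (l : Wt n) (j : ℕ) : Tm l [] [] :=
  if 0 ≤ bar l i - 1 + j then cw i l (bar l i - 1 + j).toNat
  else if j = 0 then smul ((-1) ^ (l (i + 1))) (id l [])
  else smul (-(-1) ^ (l (i + 1) - 1))
    (sum j fun k => comp (cwB i l k) (ccw i l (-bar l i - 1 + (j - k)).toNat))
termination_by j
decreasing_by exact k.2

/-- The counter-clockwise `i`-bubble of degree `2 j`, i.e. with `-(l_i - l_{i+1}) - 1 + j` dots;
a fake bubble if that number is negative. -/
def ccwB (i : ZMod n) (l : Wt n) (j : ℕ) : Tm l [] [] :=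
  if 0 ≤ -bar l i - 1 + j then ccw i l (-bar l i - 1 + j).toNat
  else if j = 0 then smul ((-1) ^ (l (i + 1) - 1)) (id l [])
  else smul (-(-1) ^ (l (i + 1)))
    (sum j fun k => comp (ccwB i l k) (cw i l (bar l i - 1 + (j - k)).toNat))
termination_by j
decreasing_by exact k.2

/-- The sideways crossing `E_i F_j → F_j E_i`. -/
def crossEF (i j : ZMod n) (l : Wt n) : Tm l [E i, F j] [F j, E i] :=
  comp (wh [F j, E i] [] (cap (F j) l))
    (comp (wh [F j] [F j] (cross .up j i (wt [F j] l)))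
      (wh [] [E i, F j] (cup (E j) (wt [E i, F j] l))))

/-- The sideways crossing `F_i E_j → E_j F_i`. -/
def crossFE (i j : ZMod n) (l : Wt n) : Tm l [F i, E j] [E j, F i] :=
  comp (wh [] [E j, F i] (cap (E i) (wt [E j, F i] l)))
    (comp (wh [F i] [F i] (cross .up j i (wt [F i] l)))
      (wh [F i, E j] [] (cup (F i) l)))

/-- The strand `c` crosses the strands `cs` from right to left. -/
def moveLeft (l : Wt n) (c : ZMod n) : (cs : List (ZMod n)) →
    Tm l (ups (cs ++ [c])) (ups (c :: cs))
  | [] => id l [E c]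
  | d :: cs => comp
      (hcomp (cross .up d c (wt (ups cs) l)) (id l (ups cs)) rfl rfl rfl)
      (hcomp (id (wt (ups (cs ++ [c])) l) [E d]) (moveLeft l c cs) rfl rfl rfl)

/-- The strand `c` crosses the strands `cs` from left to right. -/
def moveRight (l : Wt n) (c : ZMod n) : (cs : List (ZMod n)) →
    Tm l (ups (c :: cs)) (ups (cs ++ [c]))
  | [] => id l [E c]
  | d :: cs => comp
      (hcomp (id (wt (ups (c :: cs)) l) [E d]) (moveRight l c cs) rfl rfl rfl)
      (hcomp (cross .up c d (wt (ups cs) l)) (id l (ups cs)) rfl rfl rfl)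

theorem ups_append (A B : List (ZMod n)) : ups (A ++ B) = ups A ++ ups B := by
  induction A with
  | nil => rfl
  | cons a A ih => simp [ups, ih]

/-- The block `A` of parallel strands crosses the block `B`. -/
def blockSwap (l : Wt n) (A : List (ZMod n)) : (B : List (ZMod n)) →
    Tm l (ups (A ++ B)) (ups (B ++ A))
  | [] => hcomp (id l (ups A)) (id l []) rfl (by simp) (by simp)
  | c :: B => comp
      (hcomp (id (wt (ups (A ++ B)) l) [E c]) (blockSwap l A B) rfl rfl rfl)
      (hcomp (moveLeft (wt (ups B) l) c A) (id l (ups B)) rfl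
        (by simp [← ups_append]) (by simp [ups, ups_append]))

/-- `HasDeg f d`: the expression `f` is homogeneous of degree `d`. -/
inductive HasDeg : {l : Wt n} → {X Y : Word n} → Tm l X Y → ℤ → Prop
  | id (l : Wt n) (X : Word n) : HasDeg (id l X) 0
  | dot (s : Dir) (i : ZMod n) (l : Wt n) : HasDeg (dot s i l) 2
  | cross (s : Dir) (i j : ZMod n) (l : Wt n) : HasDeg (cross s i j l) (-cartan i j)
  | cup_root (s : Dir) (i : ZMod n) (l : Wt n) :
      HasDeg (cup (.root s i) l) (1 + s.sgn * bar l i)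
  | cap_root (s : Dir) (i : ZMod n) (l : Wt n) :
      HasDeg (cap (.root s i) l) (1 + s.sgn * bar l i)
  | cup_delta (s : Dir) (l : Wt n) : HasDeg (cup (.delta s) l) 0
  | cap_delta (s : Dir) (l : Wt n) : HasDeg (cap (.delta s) l) 0
  | split (i : ZMod n) (cs : List (ZMod n)) (h : cs = cyc i) (l : Wt n) :
      HasDeg (split i cs h l) 1
  | merge (i : ZMod n) (cs : List (ZMod n)) (h : cs = cyc i) (l : Wt n) :
      HasDeg (merge i cs h l) 1
  | splitDn (i : ZMod n) (l : Wt n) : HasDeg (splitDn i l) 1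
  | mergeDn (i : ZMod n) (l : Wt n) : HasDeg (mergeDn i l) 1
  | comp {l : Wt n} {X Y Z : Word n} {g : Tm l Y Z} {f : Tm l X Y} {d e : ℤ}
      (hg : HasDeg g d) (hf : HasDeg f e) : HasDeg (comp g f) (d + e)
  | hcomp {l m : Wt n} {X' Y' X Y P Q : Word n} {f : Tm m X' Y'} {g : Tm l X Y} {d e : ℤ}
      (hf : HasDeg f d) (hg : HasDeg g e)
      (hm : wt X l = m) (hP : X' ++ X = P) (hQ : Y' ++ Y = Q) :
      HasDeg (hcomp f g hm hP hQ) (d + e)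
  | zero (l : Wt n) (X Y : Word n) (d : ℤ) : HasDeg (zero l X Y) d
  | add {l : Wt n} {X Y : Word n} {f g : Tm l X Y} {d : ℤ}
      (hf : HasDeg f d) (hg : HasDeg g d) : HasDeg (add f g) d
  | smul {l : Wt n} {X Y : Word n} {f : Tm l X Y} {d : ℤ} (c : ℚ)
      (hf : HasDeg f d) : HasDeg (smul c f) d

end Tm

/-! ## Relations -/

open Tm in
/-- The relations on 2-morphisms. `HOM` below is the quotient by the equivalence relation that
they generate. -/
inductive Rel {n : ℕ} [NeZero n] : {l : Wt n} → {X Y : Word n} → Tm l X Y → Tm l X Y → Prop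
  -- congruence
  | comp_left {l : Wt n} {X Y Z : Word n} {g g' : Tm l Y Z} (f : Tm l X Y) :
      Rel g g' → Rel (comp g f) (comp g' f)
  | comp_right {l : Wt n} {X Y Z : Word n} (g : Tm l Y Z) {f f' : Tm l X Y} :
      Rel f f' → Rel (comp g f) (comp g f')
  | hcomp_left {l m : Wt n} {X' Y' X Y P Q : Word n} {f f' : Tm m X' Y'} (g : Tm l X Y)
      (hm : wt X l = m) (hP : X' ++ X = P) (hQ : Y' ++ Y = Q) :
      Rel f f' → Rel (hcomp f g hm hP hQ) (hcomp f' g hm hP hQ)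
  | hcomp_right {l m : Wt n} {X' Y' X Y P Q : Word n} (f : Tm m X' Y') {g g' : Tm l X Y}
      (hm : wt X l = m) (hP : X' ++ X = P) (hQ : Y' ++ Y = Q) :
      Rel g g' → Rel (hcomp f g hm hP hQ) (hcomp f g' hm hP hQ)
  | add_left {l : Wt n} {X Y : Word n} {f f' : Tm l X Y} (g : Tm l X Y) :
      Rel f f' → Rel (add f g) (add f' g)
  | add_right {l : Wt n} {X Y : Word n} (f : Tm l X Y) {g g' : Tm l X Y} :
      Rel g g' → Rel (add f g) (add f g')
  | smul_right {l : Wt n} {X Y : Word n} (c : ℚ) {f f' : Tm l X Y} :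
      Rel f f' → Rel (smul c f) (smul c f')
  -- vector space axioms
  | add_assoc {l : Wt n} {X Y : Word n} (f g h : Tm l X Y) :
      Rel (add (add f g) h) (add f (add g h))
  | add_comm {l : Wt n} {X Y : Word n} (f g : Tm l X Y) : Rel (add f g) (add g f)
  | zero_add {l : Wt n} {X Y : Word n} (f : Tm l X Y) : Rel (add (zero l X Y) f) f
  | smul_add {l : Wt n} {X Y : Word n} (c : ℚ) (f g : Tm l X Y) :
      Rel (smul c (add f g)) (add (smul c f) (smul c g))
  | add_smul {l : Wt n} {X Y : Word n} (c d : ℚ) (f : Tm l X Y) :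
      Rel (smul (c + d) f) (add (smul c f) (smul d f))
  | mul_smul {l : Wt n} {X Y : Word n} (c d : ℚ) (f : Tm l X Y) :
      Rel (smul (c * d) f) (smul c (smul d f))
  | one_smul {l : Wt n} {X Y : Word n} (f : Tm l X Y) : Rel (smul 1 f) f
  | zero_smul {l : Wt n} {X Y : Word n} (f : Tm l X Y) : Rel (smul 0 f) (zero l X Y)
  -- bilinearity of the two compositions
  | comp_add {l : Wt n} {X Y Z : Word n} (g : Tm l Y Z) (f f' : Tm l X Y) :
      Rel (comp g (add f f')) (add (comp g f) (comp g f'))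
  | add_comp {l : Wt n} {X Y Z : Word n} (g g' : Tm l Y Z) (f : Tm l X Y) :
      Rel (comp (add g g') f) (add (comp g f) (comp g' f))
  | comp_smul {l : Wt n} {X Y Z : Word n} (c : ℚ) (g : Tm l Y Z) (f : Tm l X Y) :
      Rel (comp g (smul c f)) (smul c (comp g f))
  | smul_comp {l : Wt n} {X Y Z : Word n} (c : ℚ) (g : Tm l Y Z) (f : Tm l X Y) :
      Rel (comp (smul c g) f) (smul c (comp g f))
  | hcomp_add {l m : Wt n} {X' Y' X Y P Q : Word n} (f : Tm m X' Y') (g g' : Tm l X Y)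
      (hm : wt X l = m) (hP : X' ++ X = P) (hQ : Y' ++ Y = Q) :
      Rel (hcomp f (add g g') hm hP hQ) (add (hcomp f g hm hP hQ) (hcomp f g' hm hP hQ))
  | add_hcomp {l m : Wt n} {X' Y' X Y P Q : Word n} (f f' : Tm m X' Y') (g : Tm l X Y)
      (hm : wt X l = m) (hP : X' ++ X = P) (hQ : Y' ++ Y = Q) :
      Rel (hcomp (add f f') g hm hP hQ) (add (hcomp f g hm hP hQ) (hcomp f' g hm hP hQ))
  | hcomp_smul {l m : Wt n} {X' Y' X Y P Q : Word n} (c : ℚ) (f : Tm m X' Y') (g : Tm l X Y)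
      (hm : wt X l = m) (hP : X' ++ X = P) (hQ : Y' ++ Y = Q) :
      Rel (hcomp f (smul c g) hm hP hQ) (smul c (hcomp f g hm hP hQ))
  | smul_hcomp {l m : Wt n} {X' Y' X Y P Q : Word n} (c : ℚ) (f : Tm m X' Y') (g : Tm l X Y)
      (hm : wt X l = m) (hP : X' ++ X = P) (hQ : Y' ++ Y = Q) :
      Rel (hcomp (smul c f) g hm hP hQ) (smul c (hcomp f g hm hP hQ))
  -- axioms of a strict 2-category
  | id_comp {l : Wt n} {X Y : Word n} (f : Tm l X Y) : Rel (comp (id l Y) f) f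
  | comp_id {l : Wt n} {X Y : Word n} (f : Tm l X Y) : Rel (comp f (id l X)) f
  | comp_assoc {l : Wt n} {X Y Z W : Word n} (h : Tm l Z W) (g : Tm l Y Z) (f : Tm l X Y) :
      Rel (comp (comp h g) f) (comp h (comp g f))
  | hcomp_id {l m : Wt n} {X' X P : Word n} (hm : wt X l = m) (hP : X' ++ X = P) :
      Rel (hcomp (id m X') (id l X) hm hP hP) (id l P)
  | id_hcomp {l m : Wt n} {X Y : Word n} (f : Tm l X Y) (hm : wt X l = m) :
      Rel (hcomp (id m []) f hm rfl rfl) f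
  | hcomp_unit {l : Wt n} {X Y : Word n} (f : Tm l X Y) :
      Rel (hcomp f (id l []) rfl (List.append_nil X) (List.append_nil Y)) f
  | hcomp_assoc {l m k : Wt n} {X₃ Y₃ X₂ Y₂ X₁ Y₁ P Q P' Q' R S : Word n}
      (f : Tm k X₃ Y₃) (g : Tm m X₂ Y₂) (h : Tm l X₁ Y₁)
      (h₁ : wt X₂ m = k) (h₂ : wt X₁ l = m) (h₃ : wt P' l = k)
      (hP : X₃ ++ X₂ = P) (hQ : Y₃ ++ Y₂ = Q) (hP' : X₂ ++ X₁ = P') (hQ' : Y₂ ++ Y₁ = Q')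
      (hR : P ++ X₁ = R) (hS : Q ++ Y₁ = S) (hR' : X₃ ++ P' = R) (hS' : Y₃ ++ Q' = S) :
      Rel (hcomp (hcomp f g h₁ hP hQ) h h₂ hR hS)
        (hcomp f (hcomp g h h₂ hP' hQ') h₃ hR' hS')
  | interchange {l m : Wt n} {X' Y' Z' X Y Z P Q R : Word n}
      (f' : Tm m Y' Z') (f : Tm m X' Y') (g' : Tm l Y Z) (g : Tm l X Y)
      (h₁ : wt X l = m) (h₂ : wt Y l = m)
      (hP : X' ++ X = P) (hQ : Y' ++ Y = Q) (hR : Z' ++ Z = R) :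
      Rel (comp (hcomp f' g' h₂ hQ hR) (hcomp f g h₁ hP hQ))
        (hcomp (comp f' f) (comp g' g) h₁ hP hR)
  -- diagrams with a region not labelled by an element of `Λ(n,n)`, or with a `δ`-strand in a
  -- region not labelled `(1^n)`, are zero
  | schur (l : Wt n) (X : Word n) (h : ¬ Admissible X l) : Rel (id l X) (zero l X X)
  -- biadjointness, for all strands
  | zigzag_right (a : Letter n) (l : Wt n) :
      Rel (comp
          (hcomp (cap a.dual (wt [a] l)) (id l [a]) rfl (by rw [a.dual_dual]; rfl) rfl)
          (wh [a] [] (cup a l))) (id l [a])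
  | zigzag_left (a : Letter n) (l : Wt n) :
      Rel (comp (wh [a] [] (cap a l))
          (hcomp (cup a.dual (wt [a] l)) (id l [a]) rfl rfl (by rw [a.dual_dual]; rfl)))
        (id l [a])
  -- cyclicity of dots and crossings
  | dot_rotR (i : ZMod n) (l : Wt n) : Rel (dot .dn i l) (rotR (dot .up i) l)
  | dot_rotL (i : ZMod n) (l : Wt n) : Rel (dot .dn i l) (rotL (dot .up i) l)
  | cross_rotR (i j : ZMod n) (l : Wt n) : Rel (cross .dn i j l) (rotR (cross .up i j) l)
  | cross_rotL (i j : ZMod n) (l : Wt n) : Rel (cross .dn i j l) (rotL (cross .up i j) l)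
  -- bubbles of negative degree and of degree zero
  | cw_neg (i : ZMod n) (l : Wt n) (m : ℕ) (h : (m : ℤ) < bar l i - 1) :
      Rel (cw i l m) (zero l [] [])
  | ccw_neg (i : ZMod n) (l : Wt n) (m : ℕ) (h : (m : ℤ) < -bar l i - 1) :
      Rel (ccw i l m) (zero l [] [])
  | cw_zero (i : ZMod n) (l : Wt n) (m : ℕ) (h : (m : ℤ) = bar l i - 1) :
      Rel (cw i l m) (smul ((-1) ^ (l (i + 1))) (id l []))
  | ccw_zero (i : ZMod n) (l : Wt n) (m : ℕ) (h : (m : ℤ) = -bar l i - 1) :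
      Rel (ccw i l m) (smul ((-1) ^ (l (i + 1) - 1)) (id l []))
  -- curls; `l` is the label of the region at the side of the curl
  | curl_right (i : ZMod n) (l : Wt n) :
      Rel (comp (wh [E i] [] (cap (F i) l))
          (comp (wh [] [F i] (cross .up i i (wt [F i] l))) (wh [E i] [] (cup (F i) l))))
        (smul (-1) (sum (-bar l i + 1).toNat fun f =>
          hcomp (dots i l (-bar l i - f).toNat) (cwB i l f) rfl rfl rfl))
  | curl_left (i : ZMod n) (l : Wt n) :
      Rel (comp (wh [] [E i] (cap (E i) (wt [E i] l)))
          (comp (wh [F i] [] (cross .up i i l)) (wh [] [E i] (cup (E i) (wt [E i] l)))))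
        (sum (bar (wt [E i] l) i + 1).toNat fun g =>
          hcomp (ccwB i (wt [E i] l) g) (dots i l (bar (wt [E i] l) i - g).toNat)
            rfl rfl rfl)
  -- the relations between `E_i F_i` and `F_i E_i`
  | EF (i : ZMod n) (l : Wt n) :
      Rel (id l [E i, F i])
        (sub (comp (crossFE i i l) (crossEF i i l))
          (sum (bar l i).toNat fun f => sum (f + 1) fun g =>
            comp (wh [] [F i] (dots i (wt [F i] l) (bar l i - 1 - f).toNat))
              (comp (cup (F i) l) (comp (ccwB i l g)
                (comp (cap (F i) l) (wh [] [F i] (dots i (wt [F i] l) (f - g)))))))) 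
  | FE (i : ZMod n) (l : Wt n) :
      Rel (id l [F i, E i])
        (sub (comp (crossEF i i l) (crossFE i i l))
          (sum (-bar l i).toNat fun f => sum (f + 1) fun g =>
            comp (wh [F i] [] (dots i l (-bar l i - 1 - f).toNat))
              (comp (cup (E i) l) (comp (cwB i l g)
                (comp (cap (E i) l) (wh [F i] [] (dots i l (f - g))))))))
  -- the relations between `E_i F_j` and `F_j E_i` for `i ≠ j`
  | EF_ne (i j : ZMod n) (h : i ≠ j) (l : Wt n) :
      Rel (comp (crossFE j i l) (crossEF i j l)) (id l [E i, F j])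
  | FE_ne (i j : ZMod n) (h : i ≠ j) (l : Wt n) :
      Rel (comp (crossEF j i l) (crossFE i j l)) (id l [F i, E j])
  -- nilHecke relations
  | nil_sq (i : ZMod n) (l : Wt n) :
      Rel (comp (cross .up i i l) (cross .up i i l)) (zero l [E i, E i] [E i, E i])
  | nil_dot_left (i : ZMod n) (l : Wt n) :
      Rel (id l [E i, E i])
        (sub (comp (dotAt l [i, i] 0) (cross .up i i l))
          (comp (cross .up i i l) (dotAt l [i, i] 1)))
  | nil_dot_right (i : ZMod n) (l : Wt n) :
      Rel (id l [E i, E i])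
        (sub (comp (cross .up i i l) (dotAt l [i, i] 0))
          (comp (dotAt l [i, i] 1) (cross .up i i l)))
  -- double crossings of different colours
  | R2_far (i j : ZMod n) (h : cartan i j = 0) (l : Wt n) :
      Rel (comp (cross .up j i l) (cross .up i j l)) (id l [E i, E j])
  | R2_succ (i j : ZMod n) (h : j = i + 1) (h' : i ≠ j) (l : Wt n) :
      Rel (comp (cross .up j i l) (cross .up i j l))
        (sub (dotAt l [i, j] 1) (dotAt l [i, j] 0))
  | R2_pred (i j : ZMod n) (h : i = j + 1) (h' : i ≠ j) (l : Wt n) :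
      Rel (comp (cross .up j i l) (cross .up i j l))
        (sub (dotAt l [i, j] 0) (dotAt l [i, j] 1))
  -- dots slide through crossings of different colours
  | slide_left (i j : ZMod n) (h : i ≠ j) (l : Wt n) :
      Rel (comp (cross .up i j l) (dotAt l [i, j] 0))
        (comp (dotAt l [j, i] 1) (cross .up i j l))
  | slide_right (i j : ZMod n) (h : i ≠ j) (l : Wt n) :
      Rel (comp (cross .up i j l) (dotAt l [i, j] 1))
        (comp (dotAt l [j, i] 0) (cross .up i j l))
  -- triple crossings
  | R3 (i j k : ZMod n) (h : ¬ (i = k ∧ cartan i j = -1)) (l : Wt n) :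
      Rel (comp (wh [] [E i] (cross .up j k (wt [E i] l)))
          (comp (wh [E j] [] (cross .up i k l)) (wh [] [E k] (cross .up i j (wt [E k] l)))))
        (comp (wh [E k] [] (cross .up i j l))
          (comp (wh [] [E j] (cross .up i k (wt [E j] l))) (wh [E i] [] (cross .up j k l))))
  | R3_succ (i j : ZMod n) (h : j = i + 1) (h' : i ≠ j) (l : Wt n) :
      Rel (sub
          (comp (wh [] [E i] (cross .up j i (wt [E i] l)))
            (comp (wh [E j] [] (cross .up i i l)) (wh [] [E i] (cross .up i j (wt [E i] l)))))
          (comp (wh [E i] [] (cross .up i j l))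
            (comp (wh [] [E j] (cross .up i i (wt [E j] l))) (wh [E i] [] (cross .up j i l)))))
        (smul (-1) (id l [E i, E j, E i]))
  | R3_pred (i j : ZMod n) (h : i = j + 1) (h' : i ≠ j) (l : Wt n) :
      Rel (sub
          (comp (wh [] [E i] (cross .up j i (wt [E i] l)))
            (comp (wh [E j] [] (cross .up i i l)) (wh [] [E i] (cross .up i j (wt [E i] l)))))
          (comp (wh [E i] [] (cross .up i j l))
            (comp (wh [] [E j] (cross .up i i (wt [E j] l))) (wh [E i] [] (cross .up j i l)))))
        (id l [E i, E j, E i])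
  -- `E_{+δ}` and `E_{-δ}` are inverse to each other
  | delta_bubble (s : Dir) :
      Rel (comp (cap (.delta s) 1) (cup (.delta s) 1)) (id (1 : Wt n) [])
  | delta_invert (s : Dir) :
      Rel (comp (cup (.delta s) 1) (cap (.delta s) 1))
        (id (1 : Wt n) [(Letter.delta s).dual, .delta s])
  -- full cyclicity of the generators joining a `δ`-strand to `n` coloured strands
  | mergeDn_rotR (i : ZMod n) :
      Rel (mergeDn i 1) (rotR (split i (cyc i) rfl) 1)
  | mergeDn_rotL (i : ZMod n) :
      Rel (mergeDn i 1) (rotL (split i (cyc i) rfl) 1)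
  | splitDn_rotR (i : ZMod n) :
      Rel (splitDn i 1) (rotR (merge i (cyc i) rfl) 1)
  | splitDn_rotL (i : ZMod n) :
      Rel (splitDn i 1) (rotL (merge i (cyc i) rfl) 1)
  -- an outer strand of a `split` or `merge` crosses all the others
  | split_moveLeft (i : ZMod n) (cs : List (ZMod n)) (h : cs ++ [i + 1] = cyc i)
      (h' : (i + 1) :: cs = cyc (i + 1)) :
      Rel (comp (moveLeft 1 (i + 1) cs) (split i (cs ++ [i + 1]) h 1))
        (comp (sub (dotAt 1 ((i + 1) :: cs) 0) (dotAt 1 ((i + 1) :: cs) 1))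
          (split (i + 1) ((i + 1) :: cs) h' 1))
  | split_moveRight (i : ZMod n) (cs : List (ZMod n)) (h : i :: cs = cyc i)
      (h' : cs ++ [i] = cyc (i - 1)) :
      Rel (comp (moveRight 1 i cs) (split i (i :: cs) h 1))
        (comp (sub (dotAt 1 (cs ++ [i]) (n - 2)) (dotAt 1 (cs ++ [i]) (n - 1)))
          (split (i - 1) (cs ++ [i]) h' 1))
  | merge_moveRight (i : ZMod n) (cs : List (ZMod n)) (h : cs ++ [i + 1] = cyc i)
      (h' : (i + 1) :: cs = cyc (i + 1)) :
      Rel (comp (merge i (cs ++ [i + 1]) h 1) (moveRight 1 (i + 1) cs))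
        (comp (merge (i + 1) ((i + 1) :: cs) h' 1)
          (sub (dotAt 1 ((i + 1) :: cs) 0) (dotAt 1 ((i + 1) :: cs) 1)))
  | merge_moveLeft (i : ZMod n) (cs : List (ZMod n)) (h : i :: cs = cyc i)
      (h' : cs ++ [i] = cyc (i - 1)) :
      Rel (comp (merge i (i :: cs) h 1) (moveLeft 1 i cs))
        (comp (merge (i - 1) (cs ++ [i]) h' 1)
          (sub (dotAt 1 (cs ++ [i]) (n - 2)) (dotAt 1 (cs ++ [i]) (n - 1))))
  -- `δ F_i → E_{i-1} ⋯ E_{i+1} → δ F_i` and `F_i δ → E_{i-1} ⋯ E_{i+1} → F_i δ` are identities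
  | delta_F (i : ZMod n) (cs : List (ZMod n)) (h : cs ++ [i] = cyc (i - 1)) (l : Wt n)
      (hl : wt [F i] l = 1) :
      Rel
        (comp (hcomp (merge (i - 1) (cs ++ [i]) h (wt [F i] l)) (id l [F i]) rfl rfl rfl)
          (comp
            (hcomp (id l (ups cs)) (cup (F i) l) rfl (List.append_nil _)
              (by simp [ups_append, ups, Letter.dual, Dir.flip]))
            (comp
              (hcomp (id (wt [E i, F i] l) (ups cs)) (cap (F i) l) rfl
                (by simp [ups_append, ups, Letter.dual, Dir.flip]) (List.append_nil _))
              (hcomp (split (i - 1) (cs ++ [i]) h (wt [F i] l)) (id l [F i]) rfl rfl rfl))))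
        (id l [.delta .up, F i])
  | F_delta (i : ZMod n) (cs : List (ZMod n)) (h : i :: cs = cyc i) :
      Rel
        (comp (hcomp (id (wt (ups (i :: cs)) 1) [F i]) (merge i (i :: cs) h 1) rfl rfl rfl)
          (comp (wh [] (ups cs) (cup (E i) (wt (ups cs) 1)))
            (comp (wh [] (ups cs) (cap (E i) (wt (ups cs) 1)))
              (hcomp (id 1 [F i]) (split i (i :: cs) h 1)
                (by simp [wt, Letter.wt]) rfl rfl))))
        (id 1 [F i, .delta .up])
  -- a `merge` followed by a `split`
  | split_merge (i : ZMod n) :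
      Rel (comp (split i (cyc i) rfl 1) (merge i (cyc i) rfl 1))
        (sub (dotAt 1 (cyc i) (n - 1)) (dotAt 1 (cyc i) 0))
  | split_merge_ne (i j : ZMod n) (hij : i ≠ j) (A B : List (ZMod n)) (hi : A ++ B = cyc i)
      (hj : B ++ A = cyc j) :
      Rel (comp (split j (B ++ A) hj 1) (merge i (A ++ B) hi 1)) (blockSwap 1 A B)

/-! ## The 2-morphism spaces -/

/-- `HOM(X 1_l, Y 1_l)`: all 2-morphisms, of all degrees. -/
def HOM {n : ℕ} [NeZero n] (l : Wt n) (X Y : Word n) : Type :=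
  Quot fun f g : Tm l X Y => Rel f g

namespace HOM

variable {n : ℕ} [NeZero n]

def mk {l : Wt n} {X Y : Word n} (f : Tm l X Y) : HOM l X Y := Quot.mk _ f

def id (l : Wt n) (X : Word n) : HOM l X X := mk (Tm.id l X)

/-- Vertical composition: `g` on top of `f`. -/
def comp {l : Wt n} {X Y Z : Word n} : HOM l Y Z → HOM l X Y → HOM l X Z :=
  Quot.map₂ Tm.comp (fun g _ _ h => .comp_right g h) (fun _ _ f h => .comp_left f h)

/-- Horizontal composition: `f` to the left of `g`. -/
def hcomp {l m : Wt n} {X' Y' X Y P Q : Word n} (f : HOM m X' Y') (g : HOM l X Y)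
    (hm : wt X l = m) (hP : X' ++ X = P) (hQ : Y' ++ Y = Q) : HOM l P Q :=
  Quot.map₂ (fun f g => Tm.hcomp f g hm hP hQ) (fun f _ _ h => .hcomp_right f hm hP hQ h)
    (fun _ _ g h => .hcomp_left g hm hP hQ h) f g

instance (l : Wt n) (X Y : Word n) : Zero (HOM l X Y) := ⟨mk (Tm.zero l X Y)⟩

instance (l : Wt n) (X Y : Word n) : Add (HOM l X Y) :=
  ⟨Quot.map₂ Tm.add (fun f _ _ h => .add_right f h) (fun _ _ g h => .add_left g h)⟩

instance (l : Wt n) (X Y : Word n) : SMul ℚ (HOM l X Y) :=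
  ⟨fun c => Quot.map (Tm.smul c) fun _ _ h => .smul_right c h⟩

theorem zero_smul' {l : Wt n} {X Y : Word n} (x : HOM l X Y) : (0 : ℚ) • x = 0 := by
  induction x using Quot.ind
  exact Quot.sound (.zero_smul _)

theorem add_smul' {l : Wt n} {X Y : Word n} (c d : ℚ) (x : HOM l X Y) :
    (c + d) • x = c • x + d • x := by
  induction x using Quot.ind
  exact Quot.sound (.add_smul _ _ _)

theorem one_smul' {l : Wt n} {X Y : Word n} (x : HOM l X Y) : (1 : ℚ) • x = x := by
  induction x using Quot.ind
  exact Quot.sound (.one_smul _)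

theorem add_comm' {l : Wt n} {X Y : Word n} (x y : HOM l X Y) : x + y = y + x := by
  induction x using Quot.ind
  induction y using Quot.ind
  exact Quot.sound (.add_comm _ _)

theorem zero_add' {l : Wt n} {X Y : Word n} (x : HOM l X Y) : 0 + x = x := by
  induction x using Quot.ind
  exact Quot.sound (.zero_add _)

theorem smul_zero' {l : Wt n} {X Y : Word n} (c : ℚ) : c • (0 : HOM l X Y) = 0 := by
  have h : ((c * 0 : ℚ)) • (0 : HOM l X Y) = c • ((0 : ℚ) • (0 : HOM l X Y)) :=
    Quot.sound (.mul_smul _ _ _)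
  rw [mul_zero, zero_smul'] at h
  exact h.symm

instance (l : Wt n) (X Y : Word n) : Neg (HOM l X Y) := ⟨fun x => (-1 : ℚ) • x⟩

instance (l : Wt n) (X Y : Word n) : AddCommGroup (HOM l X Y) where
  add_assoc x y z := by
    induction x using Quot.ind
    induction y using Quot.ind
    induction z using Quot.ind
    exact Quot.sound (.add_assoc _ _ _)
  zero_add := zero_add'
  add_zero x := by rw [add_comm', zero_add']
  nsmul := nsmulRec
  zsmul := zsmulRec
  neg_add_cancel x := by
    change (-1 : ℚ) • x + x = 0
    nth_rw 2 [← one_smul' x]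
    rw [← add_smul', neg_add_cancel, zero_smul']
  add_comm := add_comm'

instance (l : Wt n) (X Y : Word n) : Module ℚ (HOM l X Y) where
  one_smul := one_smul'
  mul_smul c d x := by
    induction x using Quot.ind
    exact Quot.sound (.mul_smul _ _ _)
  smul_zero := smul_zero'
  smul_add c x y := by
    induction x using Quot.ind
    induction y using Quot.ind
    exact Quot.sound (.smul_add _ _ _)
  add_smul := add_smul'
  zero_smul := zero_smul'

theorem comp_smul {l : Wt n} {X Y Z : Word n} (c : ℚ) (g : HOM l Y Z) (f : HOM l X Y) :
    comp g (c • f) = c • comp g f := by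
  induction g using Quot.ind
  induction f using Quot.ind
  exact Quot.sound (.comp_smul _ _ _)

theorem smul_comp {l : Wt n} {X Y Z : Word n} (c : ℚ) (g : HOM l Y Z) (f : HOM l X Y) :
    comp (c • g) f = c • comp g f := by
  induction g using Quot.ind
  induction f using Quot.ind
  exact Quot.sound (.smul_comp _ _ _)

/-- The homogeneous 2-morphisms of degree `d`. -/
def degree (l : Wt n) (X Y : Word n) (d : ℤ) : Submodule ℚ (HOM l X Y) where
  carrier := {x | ∃ f : Tm l X Y, f.HasDeg d ∧ mk f = x}
  zero_mem' := ⟨_, .zero l X Y d, rfl⟩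
  add_mem' := by
    rintro _ _ ⟨f, hf, rfl⟩ ⟨g, hg, rfl⟩
    exact ⟨_, .add hf hg, rfl⟩
  smul_mem' := by
    rintro c _ ⟨f, hf, rfl⟩
    exact ⟨_, .smul c hf, rfl⟩

end HOM

/-! ## Endomorphism rings -/

/-- `END(X 1_l)`, a ring for the vertical composition. -/
abbrev END {n : ℕ} [NeZero n] (l : Wt n) (X : Word n) : Type := HOM l X X

section

variable {n : ℕ} [NeZero n]

instance (l : Wt n) (X : Word n) : Mul (END l X) := ⟨HOM.comp⟩

instance (l : Wt n) (X : Word n) : One (END l X) := ⟨HOM.id l X⟩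

instance (l : Wt n) (X : Word n) : Ring (END l X) where
  __ := (inferInstance : AddCommGroup (HOM l X X))
  left_distrib x y z := by
    induction x using Quot.ind
    induction y using Quot.ind
    induction z using Quot.ind
    exact Quot.sound (.comp_add _ _ _)
  right_distrib x y z := by
    induction x using Quot.ind
    induction y using Quot.ind
    induction z using Quot.ind
    exact Quot.sound (.add_comp _ _ _)
  zero_mul x := by
    have h := HOM.smul_comp 0 (0 : HOM l X X) x
    rw [zero_smul, zero_smul] at h
    exact h
  mul_zero x := by
    have h := HOM.comp_smul 0 x (0 : HOM l X X)
    rw [zero_smul, zero_smul] at h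
    exact h
  mul_assoc x y z := by
    induction x using Quot.ind
    induction y using Quot.ind
    induction z using Quot.ind
    exact Quot.sound (.comp_assoc _ _ _)
  one_mul x := by
    induction x using Quot.ind
    exact Quot.sound (.id_comp _)
  mul_one x := by
    induction x using Quot.ind
    exact Quot.sound (.comp_id _)

instance (l : Wt n) (X : Word n) : Algebra ℚ (END l X) :=
  Algebra.ofModule HOM.smul_comp fun c x y => HOM.comp_smul c x y

/-! ## Placing closed diagrams beside `δ`-strands -/

/-- The closed diagram `f` to the right of `|t|` vertical `δ`-strands (upward if `t > 0`,
downward if `t < 0`). -/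
def strandsLeft (t : ℤ) (f : END (1 : Wt n) []) : END (1 : Wt n) (deltaPow n t) :=
  HOM.hcomp (HOM.id 1 (deltaPow n t)) f rfl (List.append_nil _) (List.append_nil _)

/-- The closed diagram `f` to the left of `|t|` vertical `δ`-strands. -/
def strandsRight (t : ℤ) (f : END (1 : Wt n) []) : END (1 : Wt n) (deltaPow n t) :=
  HOM.hcomp f (HOM.id 1 (deltaPow n t)) (wt_deltaPow t 1) rfl rfl

end

end AffineSchur

/-!
The 1-morphism `X = E_{+δ}^t 1_n` is invertible: for `Y = E_{+δ}^{-t} 1_n`, nested `δ`-cups and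
`δ`-caps are mutually inverse 2-morphisms of degree zero between `1_n` and `Y X`, and likewise
between `1_n` and `X Y` (`unitIso_deltas`). This uses only that `δ`-bubbles equal `1` and that a
`δ`-cap followed by the corresponding `δ`-cup is the identity.

In a strict 2-category, whiskering with an invertible 1-morphism is bijective on 2-morphisms. Let
`η : 1 → Y X` be the cups and `ε` the caps. Placing the identity of `Y` to the left of
`1_X f` gives `1_{Y X} f = η f ε`, so that `f` is recovered as `ε (1_{Y X} f) η`. Conversely, for
an endomorphism `g` of `X`, the closed diagram `f = ε (1_Y g) η` satisfies `1_Y (1_X f) = 1_Y g`,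
and `1_Y` is cancelled by placing `X` further to the left and using `X Y ≅ 1`
(`id_hcomp_injective`). The argument for diagrams to the left of the strands is the mirror image;
`bijective_of_unitIso` is the part common to both. As `η` and `ε` have degree zero, the inverse
map preserves degrees as well (`mem_degree_of_slide`).
-/

namespace AffineSchur

/-! ### Weights of composite words -/

variable {n : ℕ}

theorem wt_nil (l : Wt n) : wt [] l = l := rfl

theorem wt_append (X Y : Word n) (l : Wt n) : wt (X ++ Y) l = wt X (wt Y l) := by
  induction X with
  | nil => rfl
  | cons a X ih => simp [wt, ih]

theorem wt_deltas (s : Dir) (k : ℕ) (l : Wt n) : wt (List.replicate k (.delta s)) l = l := by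
  induction k with
  | zero => rfl
  | succ k ih => simp [List.replicate_succ, wt, ih, Letter.wt]

variable [NeZero n]

/-! ### The strict 2-category axioms for `HOM` -/

namespace HOM

theorem id_comp {l : Wt n} {X Y : Word n} (f : HOM l X Y) : comp (id l Y) f = f := by
  induction f using Quot.ind
  exact Quot.sound (.id_comp _)

theorem comp_id {l : Wt n} {X Y : Word n} (f : HOM l X Y) : comp f (id l X) = f := by
  induction f using Quot.ind
  exact Quot.sound (.comp_id _)

theorem comp_assoc {l : Wt n} {X Y Z W : Word n} (h : HOM l Z W) (g : HOM l Y Z)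
    (f : HOM l X Y) : comp (comp h g) f = comp h (comp g f) := by
  induction h using Quot.ind
  induction g using Quot.ind
  induction f using Quot.ind
  exact Quot.sound (.comp_assoc _ _ _)

theorem hcomp_id {l m : Wt n} {X' X P : Word n} (hm : wt X l = m) (hP : X' ++ X = P) :
    hcomp (id m X') (id l X) hm hP hP = id l P :=
  Quot.sound (.hcomp_id hm hP)

theorem id_hcomp {l m : Wt n} {X Y : Word n} (f : HOM l X Y) (hm : wt X l = m) :
    hcomp (id m []) f hm rfl rfl = f := by
  induction f using Quot.ind
  exact Quot.sound (.id_hcomp _ hm)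

theorem hcomp_unit {l : Wt n} {X Y : Word n} (f : HOM l X Y) :
    hcomp f (id l []) (wt_nil l) (List.append_nil X) (List.append_nil Y) = f := by
  induction f using Quot.ind
  exact Quot.sound (.hcomp_unit _)

theorem hcomp_assoc {l m k : Wt n} {X₃ Y₃ X₂ Y₂ X₁ Y₁ P Q P' Q' R S : Word n}
    (f : HOM k X₃ Y₃) (g : HOM m X₂ Y₂) (h : HOM l X₁ Y₁)
    (h₁ : wt X₂ m = k) (h₂ : wt X₁ l = m) (h₃ : wt P' l = k)
    (hP : X₃ ++ X₂ = P) (hQ : Y₃ ++ Y₂ = Q) (hP' : X₂ ++ X₁ = P') (hQ' : Y₂ ++ Y₁ = Q')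
    (hR : P ++ X₁ = R) (hS : Q ++ Y₁ = S) (hR' : X₃ ++ P' = R) (hS' : Y₃ ++ Q' = S) :
    hcomp (hcomp f g h₁ hP hQ) h h₂ hR hS = hcomp f (hcomp g h h₂ hP' hQ') h₃ hR' hS' := by
  induction f using Quot.ind
  induction g using Quot.ind
  induction h using Quot.ind
  exact Quot.sound (.hcomp_assoc _ _ _ _ _ _ _ _ _ _ _ _ _ _)

theorem interchange {l m : Wt n} {X' Y' Z' X Y Z P Q R : Word n}
    (f' : HOM m Y' Z') (f : HOM m X' Y') (g' : HOM l Y Z) (g : HOM l X Y)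
    (h₁ : wt X l = m) (h₂ : wt Y l = m)
    (hP : X' ++ X = P) (hQ : Y' ++ Y = Q) (hR : Z' ++ Z = R) :
    comp (hcomp f' g' h₂ hQ hR) (hcomp f g h₁ hP hQ) =
      hcomp (comp f' f) (comp g' g) h₁ hP hR := by
  induction f' using Quot.ind
  induction f using Quot.ind
  induction g' using Quot.ind
  induction g using Quot.ind
  exact Quot.sound (.interchange _ _ _ _ _ _ _ _ _)

theorem hcomp_add {l m : Wt n} {X' Y' X Y P Q : Word n} (f : HOM m X' Y') (g g' : HOM l X Y)
    (hm : wt X l = m) (hP : X' ++ X = P) (hQ : Y' ++ Y = Q) :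
    hcomp f (g + g') hm hP hQ = hcomp f g hm hP hQ + hcomp f g' hm hP hQ := by
  induction f using Quot.ind
  induction g using Quot.ind
  induction g' using Quot.ind
  exact Quot.sound (.hcomp_add _ _ _ _ _ _)

theorem add_hcomp {l m : Wt n} {X' Y' X Y P Q : Word n} (f f' : HOM m X' Y') (g : HOM l X Y)
    (hm : wt X l = m) (hP : X' ++ X = P) (hQ : Y' ++ Y = Q) :
    hcomp (f + f') g hm hP hQ = hcomp f g hm hP hQ + hcomp f' g hm hP hQ := by
  induction f using Quot.ind
  induction f' using Quot.ind
  induction g using Quot.ind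
  exact Quot.sound (.add_hcomp _ _ _ _ _ _)

theorem hcomp_smul {l m : Wt n} {X' Y' X Y P Q : Word n} (c : ℚ) (f : HOM m X' Y')
    (g : HOM l X Y) (hm : wt X l = m) (hP : X' ++ X = P) (hQ : Y' ++ Y = Q) :
    hcomp f (c • g) hm hP hQ = c • hcomp f g hm hP hQ := by
  induction f using Quot.ind
  induction g using Quot.ind
  exact Quot.sound (.hcomp_smul _ _ _ _ _ _)

theorem smul_hcomp {l m : Wt n} {X' Y' X Y P Q : Word n} (c : ℚ) (f : HOM m X' Y')
    (g : HOM l X Y) (hm : wt X l = m) (hP : X' ++ X = P) (hQ : Y' ++ Y = Q) :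
    hcomp (c • f) g hm hP hQ = c • hcomp f g hm hP hQ := by
  induction f using Quot.ind
  induction g using Quot.ind
  exact Quot.sound (.smul_hcomp _ _ _ _ _ _)

/-- A closed diagram to the right of the strands `P` slides through a 2-morphism `1_l → P`. -/
theorem id_hcomp_comp {l : Wt n} {P : Word n} (f : HOM l [] []) (η : HOM l [] P) :
    comp (hcomp (id l P) f (wt_nil l) (List.append_nil P) (List.append_nil P)) η = comp η f := by
  trans hcomp η f (wt_nil l) rfl (List.append_nil P)
  · nth_rw 1 [← hcomp_unit η]
    rw [interchange, id_comp, comp_id]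
  · nth_rw 2 [← hcomp_unit η, ← id_hcomp f (wt_nil l)]
    rw [interchange, id_comp, comp_id]

/-- A closed diagram to the left of the strands `P` slides through a 2-morphism `1_l → P`. -/
theorem hcomp_id_comp {l : Wt n} {P : Word n} (hl : wt P l = l) (f : HOM l [] [])
    (η : HOM l [] P) : comp (hcomp f (id l P) hl rfl rfl) η = comp η f := by
  trans hcomp f η (wt_nil l) rfl rfl
  · nth_rw 1 [← id_hcomp η (wt_nil l)]
    rw [interchange, id_comp, comp_id]
  · nth_rw 2 [← id_hcomp η (wt_nil l), ← hcomp_unit f]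
    rw [interchange, id_comp, comp_id]

theorem comp_mem_degree {l : Wt n} {X Y Z : Word n} {g : HOM l Y Z} {f : HOM l X Y} {d e : ℤ}
    (hg : g ∈ degree l Y Z d) (hf : f ∈ degree l X Y e) : comp g f ∈ degree l X Z (d + e) := by
  obtain ⟨g, hg, rfl⟩ := hg
  obtain ⟨f, hf, rfl⟩ := hf
  exact ⟨_, .comp hg hf, rfl⟩

theorem hcomp_mem_degree {l m : Wt n} {X' Y' X Y P Q : Word n} {f : HOM m X' Y'}
    {g : HOM l X Y} {d e : ℤ} (hf : f ∈ degree m X' Y' d) (hg : g ∈ degree l X Y e)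
    (hm : wt X l = m) (hP : X' ++ X = P) (hQ : Y' ++ Y = Q) :
    hcomp f g hm hP hQ ∈ degree l P Q (d + e) := by
  obtain ⟨f, hf, rfl⟩ := hf
  obtain ⟨g, hg, rfl⟩ := hg
  exact ⟨_, .hcomp hf hg hm hP hQ, rfl⟩

theorem id_mem_degree (l : Wt n) (X : Word n) : id l X ∈ degree l X X 0 :=
  ⟨_, .id l X, rfl⟩

end HOM

/-! ### Invertible 1-morphisms -/

open HOM

/-- `η` and `ε` are mutually inverse 2-morphisms of degree zero between `1_l` and `P 1_l`. -/
structure IsUnitIso {l : Wt n} {P : Word n} (η : HOM l [] P) (ε : HOM l P []) : Prop where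
  deg_η : η ∈ degree l [] P 0
  deg_ε : ε ∈ degree l P [] 0
  ε_η : comp ε η = HOM.id l []
  η_ε : comp η ε = HOM.id l P

/-- `P 1_l` is isomorphic to the identity 1-morphism of `l` in degree zero. -/
def UnitIso (l : Wt n) (P : Word n) : Prop := ∃ η ε, IsUnitIso (l := l) (P := P) η ε

theorem UnitIso.nil (l : Wt n) : UnitIso l [] :=
  ⟨HOM.id l [], HOM.id l [], id_mem_degree _ _, id_mem_degree _ _, id_comp _, id_comp _⟩

theorem UnitIso.delta_pair (s : Dir) :
    UnitIso (1 : Wt n) [(Letter.delta s).dual, .delta s] :=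
  ⟨.mk (.cup (.delta s) 1), .mk (.cap (.delta s) 1), ⟨_, .cup_delta s 1, rfl⟩,
    ⟨_, .cap_delta s 1, rfl⟩, Quot.sound (.delta_bubble s), Quot.sound (.delta_invert s)⟩

/-- Nesting: if `Y X ≅ 1` and `Q ≅ 1`, then `Y Q X ≅ 1`. -/
theorem UnitIso.insert {l : Wt n} {X Y Q : Word n} (hX : wt X l = l) (hQ : wt Q l = l)
    (h : UnitIso l (Y ++ X)) (h' : UnitIso l Q) : UnitIso l (Y ++ (Q ++ X)) := by
  obtain ⟨η, ε, h⟩ := h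
  obtain ⟨μ, ν, h'⟩ := h'
  have hQX : wt (Q ++ X) l = l := by rw [wt_append, hX, hQ]
  refine ⟨comp (hcomp (HOM.id l Y) (hcomp μ (HOM.id l X) hX rfl rfl) hX rfl rfl) η,
    comp ε (hcomp (HOM.id l Y) (hcomp ν (HOM.id l X) hX rfl rfl) hQX rfl rfl), ?_, ?_, ?_, ?_⟩
  · exact comp_mem_degree (hcomp_mem_degree (id_mem_degree _ _)
      (hcomp_mem_degree h'.deg_η (id_mem_degree _ _) _ _ _) _ _ _) h.deg_η
  · exact comp_mem_degree h.deg_ε (hcomp_mem_degree (id_mem_degree _ _)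
      (hcomp_mem_degree h'.deg_ε (id_mem_degree _ _) _ _ _) _ _ _)
  · rw [comp_assoc, ← comp_assoc _ _ η, interchange, interchange, h'.ε_η, id_comp, id_comp,
      hcomp_id, hcomp_id, id_comp, h.ε_η]
  · rw [comp_assoc, ← comp_assoc η, h.η_ε, id_comp, interchange, interchange, h'.η_ε, id_comp,
      id_comp, hcomp_id, hcomp_id]

/-- Nested `δ`-cups and `δ`-caps identify `E_{∓δ}^k E_{±δ}^k 1_n` with `1_n`. -/
theorem unitIso_deltas (s : Dir) (k : ℕ) :
    UnitIso (1 : Wt n) (List.replicate k (.delta s.flip) ++ List.replicate k (.delta s)) := by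
  induction k with
  | zero => exact .nil 1
  | succ k ih =>
    have h := ih.insert (wt_deltas s k 1) (by simp [wt, Letter.wt, Letter.dual])
      (.delta_pair s)
    rw [List.replicate_succ']
    simpa [List.replicate_succ, Letter.dual] using h

theorem unitIso_deltas_flip (s : Dir) (k : ℕ) :
    UnitIso (1 : Wt n) (List.replicate k (.delta s) ++ List.replicate k (.delta s.flip)) := by
  have h := unitIso_deltas (n := n) s.flip k
  cases s <;> exact h

/-! ### Cancelling an invertible 1-morphism -/

/-- If `Z Y ≅ 1`, then adding the strands `Y` to the left is injective: adding `Z` further to the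
left and closing `Z Y` recovers the original diagram. -/
theorem id_hcomp_injective {l : Wt n} {X Y Z : Word n} (hX : wt X l = l) (hY : wt Y l = l)
    (h : UnitIso l (Z ++ Y)) :
    Function.Injective fun g : END l X => (hcomp (HOM.id l Y) g hX rfl rfl : END l (Y ++ X)) := by
  obtain ⟨η, ε, h⟩ := h
  have hYX : wt (Y ++ X) l = l := by rw [wt_append, hX, hY]
  have key : ∀ g : END l X, comp (hcomp ε (HOM.id l X) hX (List.append_assoc _ _ _) rfl)
      (comp (hcomp (HOM.id l Z) (hcomp (HOM.id l Y) g hX rfl rfl) hYX rfl rfl)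
        (hcomp η (HOM.id l X) hX rfl (List.append_assoc _ _ _))) = g := by
    intro g
    rw [← hcomp_assoc _ _ _ hY hX _ rfl rfl _ _ (List.append_assoc _ _ _)
      (List.append_assoc _ _ _), hcomp_id, interchange, interchange, id_comp, id_comp, comp_id,
      h.ε_η, id_hcomp]
  intro g g' hg
  have hg : hcomp (HOM.id l Y) g hX rfl rfl = hcomp (HOM.id l Y) g' hX rfl rfl := hg
  rw [← key g, hg, key g']

/-- If `Y Z ≅ 1`, then adding the strands `Y` to the right is injective. -/
theorem hcomp_id_injective {l : Wt n} {X Y Z : Word n} (hY : wt Y l = l) (hZ : wt Z l = l)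
    (h : UnitIso l (Y ++ Z)) :
    Function.Injective fun g : END l X => (hcomp g (HOM.id l Y) hY rfl rfl : END l (X ++ Y)) := by
  obtain ⟨η, ε, h⟩ := h
  have hYZ : wt (Y ++ Z) l = l := by rw [wt_append, hZ, hY]
  have key : ∀ g : END l X,
      comp (hcomp (HOM.id l X) ε hYZ (List.append_assoc _ _ _).symm (List.append_nil _))
      (comp (hcomp (hcomp g (HOM.id l Y) hY rfl rfl) (HOM.id l Z) hZ rfl rfl)
        (hcomp (HOM.id l X) η (wt_nil l) (List.append_nil _)
          (List.append_assoc _ _ _).symm)) = g := by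
    intro g
    rw [hcomp_assoc _ _ _ hY hZ hYZ rfl rfl rfl rfl _ _ (List.append_assoc _ _ _).symm
      (List.append_assoc _ _ _).symm, hcomp_id, interchange, interchange, id_comp, id_comp,
      comp_id, h.ε_η, hcomp_unit]
  intro g g' hg
  have hg : hcomp g (HOM.id l Y) hY rfl rfl = hcomp g' (HOM.id l Y) hY rfl rfl := hg
  rw [← key g, hg, key g']

/-- Let `P ≅ 1` by `η`, and let `M` be an injective map such that `M (Φ f)` is the closed diagram
`f` beside the strands `P`, i.e. `f` slides from it through `η`. Then `Φ` is bijective. -/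
theorem bijective_of_unitIso {l : Wt n} {X P : Word n} {η : HOM l [] P} {ε : HOM l P []}
    (h : IsUnitIso η ε) {Φ : END l [] → END l X} {M : END l X → END l P}
    (hM : Function.Injective M) (slide : ∀ f, comp (M (Φ f)) η = comp η f) :
    Function.Bijective Φ := by
  constructor
  · intro f f' hf
    have key : ∀ f, comp ε (comp (M (Φ f)) η) = f := fun f => by
      rw [slide, ← comp_assoc, h.ε_η, id_comp]
    rw [← key f, hf, key f']
  · intro g
    refine ⟨comp ε (comp (M g) η), hM ?_⟩
    -- `M (Φ f) = M (Φ f) η ε = η f ε`, and `f = ε (M g) η` turns this into `M g`.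
    rw [← comp_id (M (Φ _)), ← h.η_ε, ← comp_assoc, slide, ← comp_assoc η, h.η_ε, id_comp,
      comp_assoc, h.η_ε, comp_id]

theorem mem_degree_of_slide {l : Wt n} {P : Word n} {η : HOM l [] P} {ε : HOM l P []}
    (h : IsUnitIso η ε) {f : END l []} {g : END l P} (slide : comp g η = comp η f) {d : ℤ}
    (hg : g ∈ degree l P P d) : f ∈ degree l [] [] d := by
  have key : comp ε (comp g η) = f := by rw [slide, ← comp_assoc, h.ε_η, id_comp]
  rw [← key]
  simpa using comp_mem_degree h.deg_ε (comp_mem_degree hg h.deg_η)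

/-! ### Closed diagrams beside `δ`-strands -/

/-- `strandsLeft` as a homomorphism of algebras. -/
def strandsLeftHom (t : ℤ) : END (1 : Wt n) [] →ₐ[ℚ] END (1 : Wt n) (deltaPow n t) :=
  AlgHom.ofLinearMap
    { toFun := strandsLeft t
      map_add' := fun f g => hcomp_add _ f g _ _ _
      map_smul' := fun c f => hcomp_smul c _ f _ _ _ }
    (hcomp_id _ _)
    (fun f g => by
      have h := interchange (HOM.id 1 (deltaPow n t)) (HOM.id 1 (deltaPow n t)) f g
        (wt_nil 1) (wt_nil 1) (List.append_nil _) (List.append_nil _) (List.append_nil _)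
      rw [id_comp] at h
      exact h.symm)

/-- `strandsRight` as a homomorphism of algebras. -/
def strandsRightHom (t : ℤ) : END (1 : Wt n) [] →ₐ[ℚ] END (1 : Wt n) (deltaPow n t) :=
  AlgHom.ofLinearMap
    { toFun := strandsRight t
      map_add' := fun f g => add_hcomp f g _ _ _ _
      map_smul' := fun c f => smul_hcomp c f _ _ _ _ }
    (hcomp_id _ _)
    (fun f g => by
      change strandsRight t (comp f g) = comp (strandsRight t f) (strandsRight t g)
      unfold strandsRight
      rw [interchange, id_comp])

theorem strandsLeft_slide {Y : Word n} (t : ℤ) (η : HOM (1 : Wt n) [] (Y ++ deltaPow n t))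
    (f : END (1 : Wt n) []) :
    comp (hcomp (HOM.id 1 Y) (strandsLeft t f) (wt_deltaPow t 1) rfl rfl) η = comp η f := by
  unfold strandsLeft
  rw [← hcomp_assoc _ _ _ (wt_deltaPow t 1) (wt_nil 1) _ rfl rfl _ _ (List.append_nil _)
    (List.append_nil _), hcomp_id, id_hcomp_comp]

theorem strandsRight_slide {Y : Word n} (hY : wt Y (1 : Wt n) = 1) (t : ℤ)
    (η : HOM (1 : Wt n) [] (deltaPow n t ++ Y)) (f : END (1 : Wt n) []) :
    comp (hcomp (strandsRight t f) (HOM.id 1 Y) hY rfl rfl) η = comp η f := by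
  have hP : wt (deltaPow n t ++ Y) (1 : Wt n) = 1 := by rw [wt_append, hY, wt_deltaPow]
  unfold strandsRight
  rw [hcomp_assoc _ _ _ (wt_deltaPow t 1) hY hP rfl rfl rfl rfl _ _ rfl rfl, hcomp_id,
    hcomp_id_comp]

/-- `E_{+δ}^t` is invertible, with an inverse `Y` on both sides. -/
theorem exists_deltaPow_inverse (n : ℕ) [NeZero n] (t : ℤ) :
    ∃ Y : Word n, wt Y (1 : Wt n) = 1 ∧ UnitIso (1 : Wt n) (Y ++ deltaPow n t) ∧
      UnitIso (1 : Wt n) (deltaPow n t ++ Y) :=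
  ⟨_, wt_deltas _ _ _, unitIso_deltas _ _, unitIso_deltas_flip _ _⟩

end AffineSchur

open AffineSchur in
theorem mainTheorem6 (n : ℕ) [NeZero n] (hn : 3 ≤ n) (t : ℤ) :
    (∃ Φ : AffineSchur.END (1 : AffineSchur.Wt n) [] ≃ₐ[ℚ]
        AffineSchur.END (1 : AffineSchur.Wt n) (AffineSchur.deltaPow n t),
      (∀ f, Φ f = AffineSchur.strandsLeft t f) ∧
      ∀ (d : ℤ) (f : AffineSchur.END (1 : AffineSchur.Wt n) []),
        f ∈ AffineSchur.HOM.degree 1 [] [] d ↔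
          Φ f ∈ AffineSchur.HOM.degree 1 (AffineSchur.deltaPow n t)
            (AffineSchur.deltaPow n t) d) ∧
    (∃ Ψ : AffineSchur.END (1 : AffineSchur.Wt n) [] ≃ₐ[ℚ]
        AffineSchur.END (1 : AffineSchur.Wt n) (AffineSchur.deltaPow n t),
      (∀ f, Ψ f = AffineSchur.strandsRight t f) ∧
      ∀ (d : ℤ) (f : AffineSchur.END (1 : AffineSchur.Wt n) []),
        f ∈ AffineSchur.HOM.degree 1 [] [] d ↔
          Ψ f ∈ AffineSchur.HOM.degree 1 (AffineSchur.deltaPow n t)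
            (AffineSchur.deltaPow n t) d) := by
  obtain ⟨Y, hY, hYX, hXY⟩ := exists_deltaPow_inverse n t
  have hX := wt_deltaPow t (1 : Wt n)
  constructor
  · obtain ⟨η, ε, h⟩ := hYX
    have slide := strandsLeft_slide t η
    refine ⟨AlgEquiv.ofBijective (strandsLeftHom t)
      (bijective_of_unitIso h (id_hcomp_injective hX hY hXY) slide), fun f => rfl,
      fun d f => ⟨fun hf => ?_, fun hf => mem_degree_of_slide h (slide f) ?_⟩⟩
    · exact zero_add d ▸ HOM.hcomp_mem_degree (HOM.id_mem_degree _ _) hf _ _ _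
    · exact zero_add d ▸ HOM.hcomp_mem_degree (HOM.id_mem_degree _ _) hf _ _ _
  · obtain ⟨η, ε, h⟩ := hXY
    have slide := strandsRight_slide hY t η
    refine ⟨AlgEquiv.ofBijective (strandsRightHom t)
      (bijective_of_unitIso h (hcomp_id_injective hY hX hYX) slide), fun f => rfl,
      fun d f => ⟨fun hf => ?_, fun hf => mem_degree_of_slide h (slide f) ?_⟩⟩
    · exact add_zero d ▸ HOM.hcomp_mem_degree hf (HOM.id_mem_degree _ _) _ _ _
    · exact add_zero d ▸ HOM.hcomp_mem_degree hf (HOM.id_mem_degree _ _) _ _ _
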